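/- For a complex square matrix $X$ let $|X|=(X^*X)^{1/2}$ (positive semidefinite square root). Let $Q_1,Q_2$ be $n\times n$ complex positive semidefinite matrices. A unitary matrix $U$ is called a polar factor of $Q_2Q_1$ if $Q_2Q_1=U|Q_2Q_1|$. Then: (a) If $Q_1$ is invertible, then for every unitary polar factor $U$ of $Q_2Q_1$ the number $\det(Q_1+U^*Q_2)$ is real and non-negative, and $\det(Q_1+U^*Q_2)\le\det(Q_1+Q_2)$. (b) For arbitrary positive semidefinite $Q_1,Q_2$ there is a unitary polar factor $U$ of $Q_2Q_1$ for which $\det(Q_1+U^*Q_2)$ is real and non-negative and $\det(Q_1+U^*Q_2)\le\det(Q_1+Q_2)$. (c) For arbitrary positive semidefinite $Q_1,Q_2$ and every unitary polar factor $U$ of $Q_2Q_1$, $|\det(Q_1+U^*Q_2)|\le\det(Q_1+Q_2)$. (d) For arbitrary positive semidefinite $Q_1,Q_2$, every unitary polar factor $U$ of $Q_2Q_1$ and every $0\le p\le1$, the Procrustes path $D_S(p)=|pQ_1+(1-p)U^*Q_2|^2$ and the Euclidean-root path $D_H(p)=|pQ_1+(1-p)Q_2|^2$ satisfy $\det D_S(p)\le\det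 D_H(p)$. -/

import Mathlib

open scoped ComplexOrder MatrixOrder

/-- The modulus `|X| = (X* X)^{1/2}` of a complex square matrix, the square root being the positive
semidefinite one. -/
noncomputable def matrixModulus {n : ℕ} (X : Matrix (Fin n) (Fin n) ℂ) :
    Matrix (Fin n) (Fin n) ℂ :=
  CFC.sqrt (X.conjTranspose * X)

/-- `X = U |X|` is a polar decomposition of `X`, with `U` unitary. -/
def IsPolarFactor {n : ℕ} (U X : Matrix (Fin n) (Fin n) ℂ) : Prop :=
  U ∈ Matrix.unitaryGroup (Fin n) ℂ ∧ X = U * matrixModulus X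

/-- The Euclidean-root path `D_H(p) = |p Q₁ + (1 - p) Q₂|²` between `Q₁²` and `Q₂²`. -/
noncomputable def euclideanRootPath {n : ℕ} (Q₁ Q₂ : Matrix (Fin n) (Fin n) ℂ) (p : ℝ) :
    Matrix (Fin n) (Fin n) ℂ :=
  matrixModulus (p • Q₁ + (1 - p) • Q₂) ^ 2

/-- The Procrustes path `D_S(p) = |p Q₁ + (1 - p) U* Q₂|²` between `Q₁²` and `Q₂²`, where `U` is
a unitary polar factor of `Q₂ Q₁`. -/
noncomputable def procrustesPath {n : ℕ} (Q₁ Q₂ U : Matrix (Fin n) (Fin n) ℂ) (p : ℝ) :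
    Matrix (Fin n) (Fin n) ℂ :=
  matrixModulus (p • Q₁ + (1 - p) • (U.conjTranspose * Q₂)) ^ 2

/-!
Write `A = Q₁`, `B = Q₂` and `P = U* B A = |B A|`; of a polar factor only the facts that `U` is
unitary and `P ≥ 0` matter. The core of the proof is the bound `|det (A + U* B)| ≤ det (A + B)`,
`Matrix.norm_det_add_polar_le`. It rests on the Cauchy–Schwarz inequality
`|det (F* H)|² ≤ det (F* F) · det (H* H)` for determinants, used twice.

* Stacking `F = (A^{1/2}, B^{1/2} U)` and `H = (A^{1/2}, B^{1/2})` gives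
  `|det (A + U* B)|² ≤ det (A + U* B U) · det (A + B)`. It therefore suffices to show
  `det (A + U* B U) ≤ |det (A + U* B)|`, which is `Matrix.norm_det_add_conj_le`.
* Since `A B U = P* = P`, one has `A U (A + U* B U) = A U A + P` and
  `A (A + U* B)* = A² + P`. For invertible `A` the claim is thus
  `|det (A U A + P)| ≤ det (A² + P)`, which is Cauchy–Schwarz for the stacks `(U* A, P^{1/2})` and
  `(A, P^{1/2})`. For singular `A` one multiplies by `A + z` instead of `A`, with `z` the projection
  onto the kernel of `A`. Both products acquire the same block on the kernel, which factors out of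
  the determinants (`Matrix.det_add_of_idempotent`).

For invertible `A` the determinant of `A + U* B` is non-negative because
`(A + U* B) A = A² + P ≥ 0`. For singular `A` the polar factor can be modified on the kernel of `A`,
which changes the determinant by an arbitrary phase. The comparison of paths is the core bound for
`p A` and `(1 - p) B`, squared: scaling by non-negative numbers keeps `U* B A` positive semidefinite.
-/

section Matrices

open scoped Matrix

variable {ι : Type*} [Fintype ι] [DecidableEq ι]

/-! ### Determinant inequalities for positive semidefinite matrices -/

theorem Matrix.PosSemidef.exists_unitary_diagonal {A : Matrix ι ι ℂ} (hA : A.PosSemidef) :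
    ∃ V ∈ Matrix.unitaryGroup ι ℂ, ∃ d : ι → ℝ, (∀ i, 0 ≤ d i) ∧
      A = V * Matrix.diagonal (fun i => (d i : ℂ)) * V.conjTranspose :=
  ⟨hA.1.eigenvectorUnitary, hA.1.eigenvectorUnitary.2, hA.1.eigenvalues, hA.eigenvalues_nonneg,
    hA.1.spectral_theorem⟩

theorem Matrix.det_unitary_conj {V : Matrix ι ι ℂ} (hV : V ∈ Matrix.unitaryGroup ι ℂ)
    (D : Matrix ι ι ℂ) : (V * D * V.conjTranspose).det = D.det := by
  have h : V.conjTranspose * V = 1 := Matrix.mem_unitaryGroup_iff'.1 hV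
  rw [Matrix.det_mul_right_comm, Matrix.det_mul, Matrix.det_mul_comm, h, Matrix.det_one, one_mul]

theorem Matrix.norm_det_of_mem_unitaryGroup {U : Matrix ι ι ℂ}
    (hU : U ∈ Matrix.unitaryGroup ι ℂ) : ‖U.det‖ = 1 := by
  have h := congrArg (fun M => ‖Matrix.det M‖) (Matrix.mem_unitaryGroup_iff.1 hU)
  simp only [Matrix.det_mul, Matrix.star_eq_conjTranspose, Matrix.det_conjTranspose, norm_mul,
    norm_star, Matrix.det_one, norm_one, ← sq] at h
  exact (pow_eq_one_iff_of_nonneg (norm_nonneg _) two_ne_zero).1 h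

theorem Matrix.PosSemidef.one_le_det_one_add {D : Matrix ι ι ℂ} (hD : D.PosSemidef) :
    1 ≤ (1 + D).det := by
  obtain ⟨V, hV, d, hd, rfl⟩ := hD.exists_unitary_diagonal
  have h : V * V.conjTranspose = 1 := Matrix.mem_unitaryGroup_iff.1 hV
  have : 1 + V * Matrix.diagonal (fun i => (d i : ℂ)) * V.conjTranspose
      = V * Matrix.diagonal (fun i => ((1 + d i : ℝ) : ℂ)) * V.conjTranspose := by
    have : Matrix.diagonal (fun i => ((1 + d i : ℝ) : ℂ))
        = 1 + Matrix.diagonal (fun i => (d i : ℂ)) := by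
      rw [← Matrix.diagonal_one, Matrix.diagonal_add]; simp
    rw [this, mul_add, add_mul, mul_one, h]
  rw [this, Matrix.det_unitary_conj hV, Matrix.det_diagonal, ← Complex.ofReal_prod]
  exact_mod_cast Finset.prod_induction (fun i => 1 + d i) (1 ≤ ·)
    (fun _ _ => one_le_mul_of_one_le_of_one_le) le_rfl (fun i _ => by linarith [hd i])

theorem Matrix.PosSemidef.det_le_det_add {S D : Matrix ι ι ℂ} (hS : S.PosSemidef)
    (hD : D.PosSemidef) : S.det ≤ (S + D).det := by
  by_cases h : S.det = 0
  · rw [h]; exact (hS.add hD).det_nonneg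
  obtain ⟨Y, hY, rfl⟩ := CStarAlgebra.isStrictlyPositive_iff_eq_star_mul_self.mp
    (hS.posDef_iff_det_ne_zero.2 h).isStrictlyPositive
  lift Y to (Matrix ι ι ℂ)ˣ using hY
  set W : Matrix ι ι ℂ := ↑(Y⁻¹)
  have h1 : W * Y = 1 := Y.inv_mul
  have h2 : (Y : Matrix ι ι ℂ).conjTranspose * W.conjTranspose = 1 := by
    rw [← Matrix.conjTranspose_mul, h1, Matrix.conjTranspose_one]
  have key : star (Y : Matrix ι ι ℂ) * Y + D
      = (Y : Matrix ι ι ℂ).conjTranspose * (1 + W.conjTranspose * D * W) * Y := by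
    rw [mul_add, add_mul, mul_one, Matrix.star_eq_conjTranspose]
    congr 1
    calc D = ((Y : Matrix ι ι ℂ).conjTranspose * W.conjTranspose) * D * (W * Y) := by
          rw [h1, h2, one_mul, mul_one]
      _ = _ := by simp only [mul_assoc]
  have h3 := (hD.conjTranspose_mul_mul_same W).one_le_det_one_add
  have h4 := hS.det_nonneg
  rw [key, Matrix.det_mul_right_comm, Matrix.det_mul _ (1 + _), ← Matrix.star_eq_conjTranspose]
  exact le_mul_of_one_le_right h4 h3

/-- The off-diagonal block of a positive semidefinite block matrix satisfies
`|det N|² ≤ det S · det T`: if `S` is invertible this is monotonicity of the determinant applied to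
the Schur complement inequality `N* S⁻¹ N ≤ T`, and if `S x = 0` then `N* x = 0`. -/
theorem Matrix.PosSemidef.norm_det_sq_le_of_fromBlocks {S N T : Matrix ι ι ℂ}
    (h : (Matrix.fromBlocks S N N.conjTranspose T).PosSemidef) :
    ((‖N.det‖ ^ 2 : ℝ) : ℂ) ≤ S.det * T.det := by
  have hS : S.PosSemidef := h.submatrix Sum.inl
  have hT : T.PosSemidef := h.submatrix Sum.inr
  by_cases h0 : S.det = 0
  · obtain ⟨x, hx0, hx⟩ := Matrix.exists_mulVec_eq_zero_iff.2 h0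
    have hz : Matrix.fromBlocks S N N.conjTranspose T *ᵥ (Sum.elim x 0) = 0 := by
      rw [← h.dotProduct_mulVec_zero_iff, Matrix.fromBlocks_mulVec]
      have hx' : star (Sum.elim x 0) ∘ Sum.inr = (0 : ι → ℂ) := by ext; simp
      simp [hx, Matrix.dotProduct_block, hx']
    have hNx : Nᴴ *ᵥ x = 0 := by
      rw [Matrix.fromBlocks_mulVec] at hz
      ext i
      simpa using congrFun hz (Sum.inr i)
    have hN : N.conjTranspose.det = 0 := Matrix.exists_mulVec_eq_zero_iff.1 ⟨x, hx0, hNx⟩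
    rw [Matrix.det_conjTranspose, star_eq_zero] at hN
    simp [hN, h0]
  have hSd := hS.posDef_iff_det_ne_zero.2 h0
  have := hSd.isUnit.invertible
  have hsch := (Matrix.PosDef.fromBlocks₁₁ N T hSd).1 h
  have h1 := (hSd.inv.posSemidef.conjTranspose_mul_mul_same N).det_le_det_add hsch
  rw [add_sub_cancel, Matrix.det_mul, Matrix.det_mul, Matrix.det_conjTranspose,
    Matrix.det_nonsing_inv, Ring.inverse_eq_inv'] at h1
  have h2 := mul_le_mul_of_nonneg_left h1 hS.det_nonneg
  refine le_trans (le_of_eq ?_) h2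
  have : star N.det * N.det = ((‖N.det‖ ^ 2 : ℝ) : ℂ) := by
    rw [Complex.star_def, Complex.conj_mul']; push_cast; rfl
  rw [← this]; field_simp

/-- The Cauchy–Schwarz inequality for determinants of Gram matrices. -/
theorem Matrix.norm_det_conjTranspose_mul_sq_le {κ : Type*} [Fintype κ] (F H : Matrix κ ι ℂ) :
    ((‖(F.conjTranspose * H).det‖ ^ 2 : ℝ) : ℂ)
      ≤ (F.conjTranspose * F).det * (H.conjTranspose * H).det := by
  apply Matrix.PosSemidef.norm_det_sq_le_of_fromBlocks
  have := Matrix.posSemidef_conjTranspose_mul_self (Matrix.fromCols F H)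
  rw [Matrix.conjTranspose_fromCols_eq_fromRows_conjTranspose, Matrix.fromRows_mul_fromCols] at this
  rwa [Matrix.conjTranspose_mul, Matrix.conjTranspose_conjTranspose]

/-! ### Existence of unitary polar factors -/

/-- If `|p| = |x|`, then `p v ↦ x v` is a well-defined isometry on the range of `p`, and extends to
the whole space. -/
theorem ContinuousLinearMap.exists_isometry_mul_eq {E : Type*} [NormedAddCommGroup E]
    [InnerProductSpace ℂ E] [FiniteDimensional ℂ E] {p x : E →L[ℂ] E}
    (hpx : star p * p = star x * x) : ∃ u : E →L[ℂ] E, star u * u = 1 ∧ u * p = x := by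
  have hnorm : ∀ v, ‖p v‖ = ‖x v‖ := by
    intro v
    have h1 : ∀ T : E →L[ℂ] E, inner ℂ ((star T * T) v) v = ((‖T v‖ ^ 2 : ℝ) : ℂ) := by
      intro T
      rw [ContinuousLinearMap.star_eq_adjoint, mul_apply_eq_comp,
        ContinuousLinearMap.adjoint_inner_left, inner_self_eq_norm_sq_to_K]
      push_cast; rfl
    have h2 := h1 p
    rw [hpx, h1 x] at h2
    exact (sq_eq_sq₀ (norm_nonneg _) (norm_nonneg _)).1 (Complex.ofReal_injective h2.symm)
  obtain ⟨g, hg⟩ := p.toLinearMap.rangeRestrict.exists_rightInverse_of_surjective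
    (LinearMap.range_rangeRestrict _)
  have hg' : ∀ s, p (g s) = s := fun s => congrArg Subtype.val (LinearMap.congr_fun hg s)
  let L : LinearMap.range p.toLinearMap →ₗᵢ[ℂ] E :=
    ⟨x.toLinearMap ∘ₗ g, fun s => by
      change ‖x (g s)‖ = ‖s‖
      rw [← hnorm, hg']; rfl⟩
  refine ⟨L.extend.toContinuousLinearMap,
    (ContinuousLinearMap.norm_map_iff_adjoint_comp_self _).1 L.extend.norm_map, ?_⟩
  ext1 v
  have h1 : L.extend (p v) = x (g ⟨p v, v, rfl⟩) := L.extend_apply ⟨p v, v, rfl⟩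
  change L.extend (p v) = x v
  rw [h1, ← sub_eq_zero, ← map_sub, ← norm_eq_zero, ← hnorm, map_sub, hg', sub_self, norm_zero]

theorem Matrix.exists_unitary_mul_eq {X P : Matrix ι ι ℂ} (h : Pᴴ * P = Xᴴ * X) :
    ∃ U ∈ Matrix.unitaryGroup ι ℂ, X = U * P := by
  set Φ := Matrix.toEuclideanCLM (n := ι) (𝕜 := ℂ)
  obtain ⟨u, hu, hux⟩ := ContinuousLinearMap.exists_isometry_mul_eq (p := Φ P) (x := Φ X) (by
    simp only [← map_star, ← map_mul, Matrix.star_eq_conjTranspose, h])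
  obtain ⟨U, rfl⟩ := EquivLike.surjective Φ u
  refine ⟨U, ?_, ?_⟩
  · rw [Matrix.mem_unitaryGroup_iff']
    refine EquivLike.injective Φ ?_
    rw [map_mul, map_star, hu, map_one]
  · refine EquivLike.injective Φ ?_
    rw [map_mul, hux]

/-! ### The projection onto the kernel -/

/-- The orthogonal projection `z` onto the kernel of a positive semidefinite matrix. The exponent
`k` in the last clause is the dimension of the kernel. -/
theorem Matrix.PosSemidef.exists_kernel_projection {A : Matrix ι ι ℂ} (hA : A.PosSemidef) :
    ∃ z : Matrix ι ι ℂ, zᴴ = z ∧ z * z = z ∧ z * A = 0 ∧ A * z = 0 ∧ (A + z).PosDef ∧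
      ∃ k : ℕ, (k = 0 → IsUnit A) ∧ ∀ c : ℂ, (1 - z + c • z).det = c ^ k := by
  classical
  obtain ⟨V, hV, d, hd, hAd⟩ := hA.exists_unitary_diagonal
  have h : Vᴴ * V = 1 := Matrix.mem_unitaryGroup_iff'.1 hV
  have h' : V * Vᴴ = 1 := Matrix.mem_unitaryGroup_iff.1 hV
  let e : ι → ℂ := fun i => if d i = 0 then 1 else 0
  have hmul : ∀ f g : ι → ℂ, (V * Matrix.diagonal f * Vᴴ) * (V * Matrix.diagonal g * Vᴴ)
      = V * Matrix.diagonal (fun i => f i * g i) * Vᴴ := by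
    intro f g
    rw [← Matrix.diagonal_mul_diagonal]
    calc _ = V * Matrix.diagonal f * (Vᴴ * V) * Matrix.diagonal g * Vᴴ := by
          simp only [mul_assoc]
      _ = _ := by rw [h]; simp only [mul_assoc, mul_one]
  have hde : ∀ i, (d i : ℂ) * e i = 0 := fun i => by by_cases hi : d i = 0 <;> simp [e, hi]
  refine ⟨V * Matrix.diagonal e * Vᴴ, ?_, ?_, ?_, ?_, ?_, (Finset.univ.filter fun i => d i = 0).card, ?_, ?_⟩
  · have : star e = e := by ext i; by_cases hi : d i = 0 <;> simp [e, hi]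
    simp [Matrix.conjTranspose_mul, Matrix.diagonal_conjTranspose, mul_assoc, this]
  · rw [hmul]; congr 3; ext i; by_cases hi : d i = 0 <;> simp [e, hi]
  · rw [hAd, hmul]; simp [mul_comm (e _), hde]
  · rw [hAd, hmul]; simp [hde]
  · have hVu : IsUnit V := IsUnit.of_mul_eq_one _ h'
    rw [hAd, ← add_mul, ← mul_add, Matrix.diagonal_add, ← Matrix.star_eq_conjTranspose,
      Matrix.IsUnit.posDef_star_right_conjugate_iff hVu, Matrix.posDef_diagonal_iff]
    intro i
    rcases (hd i).eq_or_lt with hi | hi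
    · simp [e, ← hi]
    · simpa [e, hi.ne'] using hi
  · intro hk
    have : ∀ i, d i ≠ 0 := by simpa [Finset.filter_eq_empty_iff] using hk
    rw [Matrix.isUnit_iff_isUnit_det, hAd, Matrix.det_unitary_conj hV, Matrix.det_diagonal,
      isUnit_iff_ne_zero, Finset.prod_ne_zero_iff]
    exact fun i _ => by exact_mod_cast this i
  · intro c
    have : 1 - V * Matrix.diagonal e * Vᴴ + c • (V * Matrix.diagonal e * Vᴴ)
        = V * Matrix.diagonal (fun i => if d i = 0 then c else 1) * Vᴴ := by
      have h1 : Matrix.diagonal (fun i => if d i = 0 then c else 1)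
          = 1 - Matrix.diagonal e + c • Matrix.diagonal e := by
        rw [← Matrix.diagonal_one, Matrix.diagonal_sub, ← Matrix.diagonal_smul,
          Matrix.diagonal_add]
        congr 1; ext i; by_cases hi : d i = 0 <;> simp [e, hi]
      rw [h1, mul_add, mul_sub, add_mul, sub_mul, mul_one, h', mul_smul_comm, smul_mul_assoc]
    rw [this, Matrix.det_unitary_conj hV, Matrix.det_diagonal, Finset.prod_ite]
    simp

/-! ### Comparison of `A + U* B` with `A + B` -/

/-- The Cauchy–Schwarz inequality for determinants, applied to two stacked matrices. -/
theorem Matrix.norm_det_add_sq_le {κ κ' : Type*} [Fintype κ] [Fintype κ'] (X Z : Matrix κ ι ℂ)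
    (Y W : Matrix κ' ι ℂ) :
    ((‖(Xᴴ * Z + Yᴴ * W).det‖ ^ 2 : ℝ) : ℂ)
      ≤ (Xᴴ * X + Yᴴ * Y).det * (Zᴴ * Z + Wᴴ * W).det := by
  have := Matrix.norm_det_conjTranspose_mul_sq_le (Matrix.fromRows X Y) (Matrix.fromRows Z W)
  simpa only [Matrix.conjTranspose_fromRows_eq_fromCols_conjTranspose,
    Matrix.fromCols_mul_fromRows] using this

/-- If `X` vanishes on the range of the idempotent `z` and `R` takes its values there, then `R`
enters the determinant of `X + R` only through its compression `z R z = R z`. -/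
theorem Matrix.det_add_of_idempotent {z X R : Matrix ι ι ℂ} (hz : z * z = z) (hX : X * z = 0)
    (hR : z * R = R) : (X + R).det = (X + z).det * (1 - z + R * z).det := by
  have hXR : X * R = 0 := by rw [← hR, ← mul_assoc, hX, zero_mul]
  have h1 : X + R = (X + z) * (1 - z + R) := by
    simp only [add_mul, mul_add, mul_sub, mul_one, hX, hXR, hz, hR]; abel
  have h0 : (1 - z) * R = 0 := by rw [sub_mul, one_mul, hR, sub_self]
  have h2 : 1 - z + R = (1 + R * (1 - z)) * (1 - z + R * z) := by
    have h3 : (1 - z) * (1 - z) = 1 - z := by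
      simp only [mul_sub, sub_mul, mul_one, one_mul, hz]; abel
    have h4 : (1 - z) * (R * z) = 0 := by rw [← mul_assoc, h0, zero_mul]
    rw [add_mul, one_mul, mul_assoc, mul_add, h3, h4, add_zero, mul_sub, mul_one]; abel
  rw [h1, Matrix.det_mul, h2, Matrix.det_mul (1 + _), Matrix.det_one_add_mul_comm, h0, add_zero,
    Matrix.det_one, one_mul]

variable {A B U : Matrix ι ι ℂ}

/-- Replacing `A²` by `A U A` with `U` unitary does not increase the modulus of the determinant of
`A² + P + z`. Both Gram determinants in the Cauchy–Schwarz bound equal `det (A² + P + z)`, as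
`(U* A)* (U* A) = A²`. -/
theorem Matrix.norm_det_sandwich_add_le {z P : Matrix ι ι ℂ} (hA : Aᴴ = A) (hz : zᴴ = z)
    (hzz : z * z = z) (hU : U ∈ Matrix.unitaryGroup ι ℂ) (hP : P.PosSemidef) :
    ‖(A * U * A + P + z).det‖ ≤ ‖(A * A + P + z).det‖ := by
  obtain ⟨s, rfl⟩ := CStarAlgebra.nonneg_iff_eq_star_mul_self.mp hP.nonneg
  have hUU : U * Uᴴ = 1 := Matrix.mem_unitaryGroup_iff.1 hU
  -- The stacks are `(U* A, s, z)` and `(A, s, z)`, where `P = s* s`.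
  have h := Matrix.norm_det_add_sq_le (Uᴴ * A) A (Matrix.fromRows s z) (Matrix.fromRows s z)
  have h1 : A * U * (Uᴴ * A) = A * A := by
    rw [mul_assoc, ← mul_assoc U, hUU, one_mul]
  simp only [Matrix.conjTranspose_fromRows_eq_fromCols_conjTranspose,
    Matrix.fromCols_mul_fromRows, Matrix.conjTranspose_mul, Matrix.conjTranspose_conjTranspose,
    hA, hz, hzz, h1, ← add_assoc] at h
  have h2 : (A * A + star s * s + z).PosSemidef := by
    have h3 := Matrix.posSemidef_conjTranspose_mul_self A
    have h4 := Matrix.posSemidef_conjTranspose_mul_self z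
    rw [hA] at h3
    rw [hz, hzz] at h4
    exact (h3.add hP).add h4
  rw [← Matrix.star_eq_conjTranspose, Complex.eq_coe_norm_of_nonneg h2.det_nonneg,
    ← Complex.ofReal_mul, Complex.real_le_real, ← sq] at h
  exact (sq_le_sq₀ (norm_nonneg _) (norm_nonneg _)).1 h

/-- The step that uses positivity of `P = U* B A`. Up to the common factor `det (A + z)`, where `z`
is the projection onto the kernel of `A`, the determinants of `U (A + U* B U)` and of
`(A + U* B)* = A + B U` are those of `A U A + P` and `A² + P`, completed on the kernel by the same
block. -/
theorem Matrix.norm_det_add_conj_le (hA : A.PosSemidef) (hB : Bᴴ = B)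
    (hU : U ∈ Matrix.unitaryGroup ι ℂ) (hP : (Uᴴ * B * A).PosSemidef) :
    ‖(A + Uᴴ * B * U).det‖ ≤ ‖(A + Uᴴ * B).det‖ := by
  obtain ⟨z, hz, hzz, hzA, hAz, hpos, -⟩ := hA.exists_kernel_projection
  have hA' : Aᴴ = A := hA.1
  have hUU : U * Uᴴ = 1 := Matrix.mem_unitaryGroup_iff.1 hU
  obtain ⟨P, hPdef⟩ : ∃ P, P = Uᴴ * B * A := ⟨_, rfl⟩
  rw [← hPdef] at hP
  have hPz : P * z = 0 := by rw [hPdef, mul_assoc, hAz, mul_zero]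
  have hP' : A * B * U = P := by
    rw [← hP.1.eq, hPdef]
    simp only [Matrix.conjTranspose_mul, Matrix.conjTranspose_conjTranspose, hA', hB, mul_assoc]
  have hzX : z * (z * (U * (A + Uᴴ * B * U))) = z * (U * (A + Uᴴ * B * U)) := by
    rw [← mul_assoc, hzz]
  have hzY : z * (z * (B * U)) = z * (B * U) := by rw [← mul_assoc, hzz]
  have hUB : U * (A + Uᴴ * B * U) = U * A + B * U := by
    rw [mul_add, ← mul_assoc, ← mul_assoc, hUU, one_mul]
  have e1 : (A + z) * (U * (A + Uᴴ * B * U))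
      = (A * U * A + P) + z * (U * (A + Uᴴ * B * U)) := by
    rw [add_mul, hUB, mul_add, ← mul_assoc, ← mul_assoc, hP']
  have e2 : (A + z) * (A + B * U) = (A * A + P) + z * (B * U) := by
    rw [add_mul, mul_add, mul_add, hzA, zero_add, ← mul_assoc, hP']
  have e3 : z * (U * (A + Uᴴ * B * U)) * z = z * (B * U) * z := by
    rw [hUB, mul_add, add_mul, mul_assoc z (U * A), mul_assoc U, hAz, mul_zero, mul_zero, zero_add]
  have hX : ∀ Y, (Y * A + P) * z = 0 := fun Y => by
    rw [add_mul, mul_assoc, hAz, hPz, mul_zero, add_zero]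
  have d1 : ‖(A + z).det‖ * ‖(A + Uᴴ * B * U).det‖
      = ‖(A * U * A + P + z).det‖ * ‖(1 - z + z * (B * U) * z).det‖ := by
    rw [← norm_mul _ (1 - z + _).det, ← e3, ← Matrix.det_add_of_idempotent hzz (hX _) hzX, ← e1,
      Matrix.det_mul, Matrix.det_mul U, norm_mul, norm_mul,
      Matrix.norm_det_of_mem_unitaryGroup hU, one_mul]
  have d2 : ‖(A + z).det‖ * ‖(A + B * U).det‖
      = ‖(A * A + P + z).det‖ * ‖(1 - z + z * (B * U) * z).det‖ := by
    rw [← norm_mul, ← norm_mul, ← Matrix.det_mul, e2,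
      ← Matrix.det_add_of_idempotent hzz (hX _) hzY]
  have e4 : ‖(A + B * U).det‖ = ‖(A + Uᴴ * B).det‖ := by
    rw [← norm_star, ← Matrix.det_conjTranspose]
    simp only [Matrix.conjTranspose_add, Matrix.conjTranspose_mul, hA', hB]
  have hle := Matrix.norm_det_sandwich_add_le hA' hz hzz hU hP
  have h0 : 0 < ‖(A + z).det‖ := norm_pos_iff.2 hpos.det_pos.ne'
  refine le_of_mul_le_mul_left ?_ h0
  rw [d1, ← e4, d2]
  exact mul_le_mul_of_nonneg_right hle (norm_nonneg _)

/-- If `U* B A` is positive semidefinite, then `|det (A + U* B)| ≤ det (A + B)`. The Cauchy–Schwarz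
inequality gives `|det (A + U* B)|² ≤ det (A + U* B U) · det (A + B)`, and the first factor on the
right is at most `|det (A + U* B)|`. -/
theorem Matrix.norm_det_add_polar_le (hA : A.PosSemidef) (hB : B.PosSemidef)
    (hU : U ∈ Matrix.unitaryGroup ι ℂ) (hP : (Uᴴ * B * A).PosSemidef) :
    ‖(A + Uᴴ * B).det‖ ≤ ‖(A + B).det‖ := by
  have h1 := Matrix.norm_det_add_conj_le hA hB.1 hU hP
  obtain ⟨a, ha⟩ := CStarAlgebra.nonneg_iff_eq_star_mul_self.mp hA.nonneg
  obtain ⟨b, hb⟩ := CStarAlgebra.nonneg_iff_eq_star_mul_self.mp hB.nonneg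
  rw [Matrix.star_eq_conjTranspose] at ha hb
  have h2 := Matrix.norm_det_add_sq_le a a (b * U) b
  have e1 : (b * U)ᴴ * b = Uᴴ * B := by rw [Matrix.conjTranspose_mul, hb, mul_assoc]
  rw [← mul_assoc, e1, ← ha, ← hb,
    Complex.eq_coe_norm_of_nonneg (hA.add (hB.conjTranspose_mul_mul_same U)).det_nonneg,
    Complex.eq_coe_norm_of_nonneg (hA.add hB).det_nonneg, ← Complex.ofReal_mul,
    Complex.real_le_real] at h2
  rcases (norm_nonneg (A + Uᴴ * B).det).eq_or_lt with h0 | h0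
  · rw [← h0]; exact norm_nonneg _
  · refine le_of_mul_le_mul_left ?_ h0
    rw [← sq]
    exact h2.trans (mul_le_mul_of_nonneg_right h1 (norm_nonneg _))

/-- For invertible `A`, multiplying `A + U* B` by `A` on the right gives the positive semidefinite
matrix `A² + U* B A`. -/
theorem Matrix.det_add_polar_nonneg (hA : A.PosDef) (hP : (Uᴴ * B * A).PosSemidef) :
    0 ≤ (A + Uᴴ * B).det := by
  have h1 := Matrix.posSemidef_conjTranspose_mul_self A
  rw [hA.1.eq] at h1
  have h2 := (h1.add hP).det_nonneg
  rw [← add_mul, Matrix.det_mul] at h2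
  exact le_of_mul_le_mul_right (by rwa [zero_mul]) hA.det_pos

end Matrices

/-! ### Polar factors of `B A` -/

section PolarFactors

open scoped Matrix

variable {n : ℕ} {A B U X : Matrix (Fin n) (Fin n) ℂ}

theorem matrixModulus_posSemidef (X : Matrix (Fin n) (Fin n) ℂ) : (matrixModulus X).PosSemidef :=
  Matrix.nonneg_iff_posSemidef.1 (CFC.sqrt_nonneg _)

theorem matrixModulus_mul_self (X : Matrix (Fin n) (Fin n) ℂ) :
    matrixModulus X * matrixModulus X = Xᴴ * X :=
  CFC.sqrt_mul_sqrt_self _ (Matrix.posSemidef_conjTranspose_mul_self X).nonneg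

theorem det_matrixModulus_sq (X : Matrix (Fin n) (Fin n) ℂ) :
    (matrixModulus X ^ 2).det = ((‖X.det‖ ^ 2 : ℝ) : ℂ) := by
  rw [sq, matrixModulus_mul_self, Matrix.det_mul, Matrix.det_conjTranspose, Complex.star_def,
    Complex.conj_mul']
  push_cast; rfl

theorem IsPolarFactor.conjTranspose_mul (h : IsPolarFactor U X) : Uᴴ * X = matrixModulus X := by
  conv_lhs => rw [h.2]
  rw [← mul_assoc, ← Matrix.star_eq_conjTranspose, Matrix.mem_unitaryGroup_iff'.1 h.1, one_mul]

theorem IsPolarFactor.posSemidef (h : IsPolarFactor U (B * A)) : (Uᴴ * B * A).PosSemidef := by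
  rw [mul_assoc, h.conjTranspose_mul]
  exact matrixModulus_posSemidef _

theorem exists_isPolarFactor (X : Matrix (Fin n) (Fin n) ℂ) : ∃ U, IsPolarFactor U X :=
  Matrix.exists_unitary_mul_eq (by rw [(matrixModulus_posSemidef X).1, matrixModulus_mul_self])

/-- A polar factor `U` may be multiplied on the right by a unitary that is scalar on the kernel of
`A` and the identity on its orthogonal complement. This multiplies `det (A + U* B)` by an arbitrary
phase, provided the kernel is non-trivial. -/
theorem exists_isPolarFactor_det_nonneg (hA : A.PosSemidef) :
    ∃ U, IsPolarFactor U (B * A) ∧ 0 ≤ (A + Uᴴ * B).det := by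
  obtain ⟨U, hU⟩ := exists_isPolarFactor (B * A)
  obtain ⟨z, hz, hzz, hzA, hAz, -, k, hk, hdet⟩ := hA.exists_kernel_projection
  by_cases hk0 : k = 0
  · exact ⟨U, hU, Matrix.det_add_polar_nonneg (hA.posDef_iff_isUnit.2 (hk hk0)) hU.posSemidef⟩
  set w := (A + Uᴴ * B).det
  -- `c ^ k` has to cancel the phase of `w`.
  obtain ⟨c, hc1, hc⟩ : ∃ c : ℂ, ‖c‖ = 1 ∧ 0 ≤ c ^ k * w := by
    by_cases hw : w = 0
    · exact ⟨1, norm_one, by simp [hw]⟩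
    obtain ⟨c, hc⟩ := IsAlgClosed.exists_pow_nat_eq ((‖w‖ : ℂ) / w) (Nat.pos_of_ne_zero hk0)
    refine ⟨c, ?_, ?_⟩
    · have h1 := congrArg norm hc
      rw [norm_pow, norm_div, Complex.norm_real, norm_norm, div_self (norm_ne_zero_iff.2 hw)] at h1
      exact (pow_eq_one_iff_of_nonneg (norm_nonneg _) hk0).1 h1
    · rw [hc, div_mul_cancel₀ _ hw]
      exact_mod_cast norm_nonneg w
  have hcc : star c * c = 1 := by
    rw [Complex.star_def, Complex.conj_mul', hc1]; simp
  set V := 1 - z + c • z with hV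
  have hVA : V * A = A := by
    rw [hV, add_mul, sub_mul, smul_mul_assoc, hzA, one_mul, smul_zero, sub_zero, add_zero]
  have hVh : Vᴴ = 1 - z + star c • z := by
    rw [hV, Matrix.conjTranspose_add, Matrix.conjTranspose_sub, Matrix.conjTranspose_smul, hz,
      Matrix.conjTranspose_one]
  have hVV : Vᴴ * V = 1 := by
    rw [hVh, hV]
    simp only [add_mul, mul_add, sub_mul, mul_sub, one_mul, mul_one, smul_mul_assoc,
      mul_smul_comm, hzz]
    rw [sub_self, zero_add, smul_smul, mul_comm c, hcc, one_smul]
    abel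
  have hVu : V ∈ Matrix.unitaryGroup (Fin n) ℂ := Matrix.mem_unitaryGroup_iff'.2 hVV
  have hVP : Vᴴ * matrixModulus (B * A) = matrixModulus (B * A) := by
    have h1 : matrixModulus (B * A) * z = 0 := by
      rw [← hU.conjTranspose_mul, mul_assoc, mul_assoc, hAz, mul_zero, mul_zero]
    have h2 : z * matrixModulus (B * A) = 0 := by
      have h3 := congrArg Matrix.conjTranspose h1
      rwa [Matrix.conjTranspose_mul, hz, (matrixModulus_posSemidef _).1,
        Matrix.conjTranspose_zero] at h3
    rw [hVh, add_mul, sub_mul, smul_mul_assoc, h2, one_mul, smul_zero, sub_zero, add_zero]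
  refine ⟨U * Vᴴ, ⟨mul_mem hU.1 (Unitary.star_mem hVu), ?_⟩, ?_⟩
  · rw [mul_assoc, hVP]; exact hU.2
  · have h1 : A + (U * Vᴴ)ᴴ * B = V * (A + Uᴴ * B) := by
      rw [Matrix.conjTranspose_mul, Matrix.conjTranspose_conjTranspose, mul_add, hVA, mul_assoc]
    rw [h1, Matrix.det_mul, hdet]
    exact hc

end PolarFactors

theorem theorem1 (n : ℕ) (Q₁ Q₂ : Matrix (Fin n) (Fin n) ℂ)
    (hQ₁ : Q₁.PosSemidef) (hQ₂ : Q₂.PosSemidef) :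
    -- `Q₁` invertible: the claim holds for every polar decomposition
    (IsUnit Q₁ → ∀ U : Matrix (Fin n) (Fin n) ℂ, IsPolarFactor U (Q₂ * Q₁) →
      0 ≤ (Q₁ + U.conjTranspose * Q₂).det ∧
        (Q₁ + U.conjTranspose * Q₂).det ≤ (Q₁ + Q₂).det) ∧
    -- any `Q₁`: the polar decomposition can be chosen so that the claim holds
    (∃ U : Matrix (Fin n) (Fin n) ℂ, IsPolarFactor U (Q₂ * Q₁) ∧
      0 ≤ (Q₁ + U.conjTranspose * Q₂).det ∧
        (Q₁ + U.conjTranspose * Q₂).det ≤ (Q₁ + Q₂).det) ∧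
    -- any `Q₁`, every polar decomposition: the inequality holds for the absolute value
    (∀ U : Matrix (Fin n) (Fin n) ℂ, IsPolarFactor U (Q₂ * Q₁) →
      ((‖(Q₁ + U.conjTranspose * Q₂).det‖ : ℝ) : ℂ) ≤ (Q₁ + Q₂).det) ∧
    -- any `Q₁`, every polar decomposition: comparison of the two paths
    (∀ U : Matrix (Fin n) (Fin n) ℂ, IsPolarFactor U (Q₂ * Q₁) →
      ∀ p ∈ Set.Icc (0 : ℝ) 1,
        (procrustesPath Q₁ Q₂ U p).det ≤ (euclideanRootPath Q₁ Q₂ p).det) := by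
  have hnorm : ∀ U : Matrix (Fin n) (Fin n) ℂ, IsPolarFactor U (Q₂ * Q₁) →
      ((‖(Q₁ + U.conjTranspose * Q₂).det‖ : ℝ) : ℂ) ≤ (Q₁ + Q₂).det := by
    intro U hU
    rw [Complex.eq_coe_norm_of_nonneg (hQ₁.add hQ₂).det_nonneg, Complex.real_le_real]
    exact Matrix.norm_det_add_polar_le hQ₁ hQ₂ hU.1 hU.posSemidef
  have hle : ∀ U : Matrix (Fin n) (Fin n) ℂ, IsPolarFactor U (Q₂ * Q₁) →
      0 ≤ (Q₁ + U.conjTranspose * Q₂).det →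
        0 ≤ (Q₁ + U.conjTranspose * Q₂).det ∧
          (Q₁ + U.conjTranspose * Q₂).det ≤ (Q₁ + Q₂).det :=
    fun U hU h0 => ⟨h0, (Complex.eq_coe_norm_of_nonneg h0).le.trans (hnorm U hU)⟩
  refine ⟨fun hu U hU => hle U hU ?_, ?_, hnorm, fun U hU p hp => ?_⟩
  · exact Matrix.det_add_polar_nonneg (hQ₁.posDef_iff_isUnit.2 hu) hU.posSemidef
  · obtain ⟨U, hU, h0⟩ := exists_isPolarFactor_det_nonneg (B := Q₂) hQ₁
    exact ⟨U, hU, hle U hU h0⟩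
  · rw [procrustesPath, euclideanRootPath, det_matrixModulus_sq, det_matrixModulus_sq,
      Complex.real_le_real]
    have hp1 : 0 ≤ 1 - p := sub_nonneg.2 hp.2
    refine pow_le_pow_left₀ (norm_nonneg _) ?_ 2
    rw [← mul_smul_comm]
    refine Matrix.norm_det_add_polar_le (hQ₁.smul hp.1) (hQ₂.smul hp1) hU.1 ?_
    rw [mul_smul_comm p, mul_smul_comm (1 - p), smul_mul_assoc]
    exact (hU.posSemidef.smul hp1).smul hp.1
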